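/- Let $\kappa$ be a regular uncountable cardinal and let $\lambda\ge\kappa$ be a cardinal. Notation. For a cardinal $\mu\ge\kappa$ put $P_\kappa(\mu)=\{a\subseteq\mu : |a|<\kappa\}$. A set $B\subseteq P_\kappa(\mu)$ lies in $I^+_{\kappa,\mu}$ if for every $a\in P_\kappa(\mu)$ there is $b\in B$ with $a\subseteq b$. For an infinite cardinal $\tau\le\kappa$, $PS^+(\tau,\kappa,\mu)$ is the assertion that, given for each $a\in P_\kappa(\mu)$ a partition $Q_a$ of $P_\kappa(\mu)$ into nonempty pieces with $|Q_a|<\tau$, there are $B\in I^+_{\kappa,\mu}$ and $h\in\prod_{a\in P_\kappa(\mu)}Q_a$ such that for all $a,b\in B$ the set $\{c\in h(a)\cap h(b) : a\cup b\subseteq c\}$ is nonempty. Ideals on a set $X$ are proper ($X$ does not belong to the ideal). If $I$ is an ideal on a set $A$ of cardinals, then for $f,g\in\prod A=\prod_{a\in A}a$ we write $f<_I g$ if $\{a\in A : f(a)\ge g(a)\}\in I$. For a regular cardinal $\pi>\sup A$, $\mathrm{tcf}(\prod A/I)=\pi$ means that there is an increasing, cofinal sequence of length $\pi$ in $(\prod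 A,<_I)$ (a scale of length $\pi$). Given such a sequence $\vec f=\langle f_\alpha:\alpha<\pi\rangle$, an infinite limit ordinal $\delta<\pi$ is a remarkably good point for $\vec f$ if there are a closed unbounded set $X\subseteq\delta$ and sets $Z_\xi\in I$ for $\xi\in X$ such that $f_\beta(a)<f_\xi(a)$ whenever $\beta<\xi$ are in $X$ and $a\in A\setminus(Z_\beta\cup Z_\xi)$. Proposition 2.15. Let $A$ be an infinite set of regular cardinals such that $|A|<\min\{\kappa,\min A\}$ and $\sup A=\lambda$. Let $I$ be an ideal on $A$ such that $\{A\cap a : a\in A\}\subseteq I$ and $\mathrm{tcf}(\prod A/I)=\lambda^+$. Suppose that $PS^+(|A|^+,\kappa,\lambda^+)$ holds. Let $\vec f=\langle f_\alpha:\alpha<\lambda^+\rangle$ be an increasing, cofinal sequence in $(\prod A,<_I)$. Then the set of all infinite limit ordinals $\delta<\lambda^+$ such that $\mathrm{cf}(\delta)<\kappa$ and $\delta$ is not a remarkably good point for $\vec f$ is stationary in $\lambda^+$. -/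

import Mathlib

universe u

open Cardinal Order
open Set (Iio)

/-- `P_κ(μ)`: the subsets of (the initial ordinal of) `μ` of size less than `κ`. -/
def PSub (κ μ : Cardinal.{u}) : Type (u + 1) :=
  {a : Set (Iio μ.ord) // #a < Cardinal.lift.{u + 1} κ}

/-- The ideal `I_{κ,μ} = ⋃_{a ∈ P_κ(μ)} P({b ∈ P_κ(μ) : a \ b ≠ ∅})` on `P_κ(μ)`. -/
def noncofinalIdeal (κ μ : Cardinal.{u}) : Set (Set (PSub κ μ)) :=
  ⋃ a : PSub κ μ, 𝒫 {b : PSub κ μ | (a.1 \ b.1).Nonempty}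

/-- The piece selection principle `PS⁺(τ, κ, μ)`. The cardinal `τ` is in the universe of the sets
of ordinals below `μ`; the principle is meant for infinite `τ ≤ κ`. -/
def PSPlus (τ : Cardinal.{u + 1}) (κ μ : Cardinal.{u}) : Prop :=
  ∀ Q : PSub κ μ → Set (Set (PSub κ μ)),
    (∀ a, Setoid.IsPartition (Q a) ∧ #(Q a) < τ) →
    ∃ B : Set (PSub κ μ), B ∉ noncofinalIdeal κ μ ∧
      ∃ h : PSub κ μ → Set (PSub κ μ), (∀ a, h a ∈ Q a) ∧
        ∀ a ∈ B, ∀ b ∈ B, {c ∈ h a ∩ h b | a.1 ∪ b.1 ⊆ c.1}.Nonempty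

/-- The product `∏ A = ∏_{a ∈ A} a`, each cardinal being identified with its initial ordinal. -/
abbrev CardProd (A : Set Cardinal.{u}) : Type (u + 1) :=
  (a : A) → Iio (a : Cardinal.{u}).ord

/-- `f <_I g`: the set `{a ∈ A : f(a) ≥ g(a)}` is in `I`. -/
def ltMod {A : Set Cardinal.{u}} (I : Order.Ideal (Set A)) (f g : CardProd A) : Prop :=
  {a : A | f a ≥ g a} ∈ I

/-- `f = ⟨f_α : α < π⟩` is an increasing, cofinal sequence in `(∏ A, <_I)`. -/
structure IsScale {A : Set Cardinal.{u}} (I : Order.Ideal (Set A)) {π : Cardinal.{u}}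
    (f : Iio π.ord → CardProd A) : Prop where
  increasing : ∀ α β, α < β → ltMod I (f α) (f β)
  cofinal : ∀ g : CardProd A, ∃ α, ltMod I g (f α)

/-- `tcf(∏ A / I) = π`: the cardinal `π` is regular and greater than `sup A`, and there is an
increasing cofinal sequence of length `π` in `(∏ A, <_I)`. -/
def HasTcf {A : Set Cardinal.{u}} (I : Order.Ideal (Set A)) (π : Cardinal.{u}) : Prop :=
  π.IsRegular ∧ (∃ σ < π, IsLUB A σ) ∧ ∃ f : Iio π.ord → CardProd A, IsScale I f

/-- `δ` is a remarkably good point for `f`: it is an infinite limit ordinal, and there are a closed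
unbounded subset `X` of `δ` and sets `Z_ξ ∈ I` for `ξ ∈ X` such that `f_β(a) < f_ξ(a)` whenever
`β < ξ` are in `X` and `a ∈ A \ (Z_β ∪ Z_ξ)`. -/
def IsRemarkablyGoodPoint {A : Set Cardinal.{u}} (I : Order.Ideal (Set A)) {π : Cardinal.{u}}
    (f : Iio π.ord → CardProd A) (δ : Iio π.ord) : Prop :=
  IsSuccLimit (δ : Ordinal.{u}) ∧
    ∃ X : Set (Iio δ), IsClub X ∧ ∃ Z : Iio δ → Set A, (∀ ξ ∈ X, Z ξ ∈ I) ∧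
      ∀ β ∈ X, ∀ ξ ∈ X, β < ξ → ∀ a : A, a ∉ Z β ∪ Z ξ → f β a < f ξ a

/-! If the set were not stationary, some club `C` would avoid it. By induction on a bound, `f` is
then free on every subset of `C` of size less than `κ`. Let `g a` be the least point of `C` bounding
`a`. For each `c`, `f` is free on `g '' 𝒫 c`, with exceptional sets `Z c`; colour `(a, c)` by a
coordinate outside `Z c (g a)`. `PSPlus` gives a cofinal `B` and colours `k` such that any `a, b ∈
B` have a common `c` realizing `k a` and `k b`. As `|A| < cf(λ⁺)`, one colour `i` occurs on a
cofinal set of values `g a`. There `f · i` is strictly increasing, so `i` has at least `λ⁺`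
elements, although `i ≤ λ`. -/

/-- The sequence `f` is free on `x` modulo `I`: after removing a small set `Z ξ` of coordinates from
each `f ξ`, the sequence is everywhere strictly increasing along `x`. -/
def IsFreeOn {ι α : Type*} [LinearOrder α] {V : ι → Type*} [∀ i, LinearOrder (V i)]
    (I : Order.Ideal (Set ι)) (f : α → ∀ i, V i) (x : Set α) : Prop :=
  ∃ Z : α → Set ι, (∀ ξ, Z ξ ∈ I) ∧
    ∀ β ∈ x, ∀ ξ ∈ x, β < ξ → ∀ i, i ∉ Z β ∪ Z ξ → f β i < f ξ i

/-! ### Freeness modulo an ideal -/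

section Free

variable {ι α : Type*} [LinearOrder α] {V : ι → Type*} [∀ i, LinearOrder (V i)]
  {I : Order.Ideal (Set ι)} {f : α → ∀ i, V i}

theorem Order.Ideal.union_mem {ι : Type*} {I : Order.Ideal (Set ι)} {s t : Set ι}
    (hs : s ∈ I) (ht : t ∈ I) : s ∪ t ∈ I :=
  Order.Ideal.sup_mem hs ht

theorem Order.Ideal.empty_mem {ι : Type*} (I : Order.Ideal (Set ι)) : (∅ : Set ι) ∈ I :=
  Order.Ideal.bot_mem I

theorem IsFreeOn.mono {x y : Set α} (hy : IsFreeOn I f y) (hxy : x ⊆ y) : IsFreeOn I f x := by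
  obtain ⟨Z, hZ, h⟩ := hy
  exact ⟨Z, hZ, fun β hβ ξ hξ => h β (hxy hβ) ξ (hxy hξ)⟩

theorem IsFreeOn.insert_of_subset_Iio (hf : ∀ α β, α < β → {i | f β i ≤ f α i} ∈ I)
    {x : Set α} {m : α} (hx : IsFreeOn I f x) (hxm : x ⊆ Iio m) : IsFreeOn I f (insert m x) := by
  classical
  obtain ⟨Z, hZ, h⟩ := hx
  -- The failures of `f β < f m` are charged to `β`, so `m` needs no exceptional set.
  refine ⟨fun β => if β < m then Z β ∪ {i | f m i ≤ f β i} else ∅, fun ξ => ?_, ?_⟩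
  · dsimp only
    split_ifs with hξ
    · exact Order.Ideal.union_mem (hZ ξ) (hf _ _ hξ)
    · exact Order.Ideal.empty_mem I
  · rintro β hβ ξ hξ hlt i hi
    have hβm : β < m := by
      rcases hξ with rfl | hξ
      · exact hlt
      · exact hlt.trans (hxm hξ)
    have hβx : β ∈ x := hβ.resolve_left hβm.ne
    simp only [hβm, if_true, Set.mem_union, Set.mem_ofPred_eq, not_or, not_le] at hi
    rcases hξ with rfl | hξ
    · exact hi.1.2
    · have hξm : ξ < m := hxm hξ
      simp only [hξm, if_true, Set.mem_union, Set.mem_ofPred_eq, not_or, not_le] at hi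
      exact h β hβx ξ hξ hlt i (by simp [hi.1.1, hi.2.1])

/-- Gluing freeness over the intervals determined by a closed unbounded set `X` below `δ`
on which `f` is free. -/
theorem IsFreeOn.of_closed_unbounded [WellFoundedLT α]
    (hf : ∀ α β, α < β → {i | f β i ≤ f α i} ∈ I) {δ : α} {x X : Set α}
    (hx : x ⊆ Iio δ) (hxX : ∀ η ∈ X, IsFreeOn I f (x ∩ Iio η)) (hX : IsFreeOn I f X)
    (hcof : ∀ β < δ, ∃ η ∈ X, β < η)
    (hclosed : ∀ γ < δ, ∀ ξ ∈ X, ξ ≤ γ → ∃ m, IsGreatest (X ∩ Set.Iic γ) m) :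
    IsFreeOn I f x := by
  classical
  choose! Z hZ hZlt using hxX
  obtain ⟨W, hW, hWlt⟩ := hX
  have hnext : ∀ β : α, ∃ η, β < δ → IsLeast (X ∩ Set.Ioi β) η := by
    intro β
    by_cases hβ : β < δ
    · obtain ⟨η, hη, hβη⟩ := hcof β hβ
      have hne : (X ∩ Set.Ioi β).Nonempty := ⟨η, hη, hβη⟩
      exact ⟨WellFounded.min wellFounded_lt _ hne, fun _ => ⟨WellFounded.min_mem _ _ hne,
        fun z hz => WellFounded.min_le _ hz⟩⟩
    · exact ⟨β, fun h => absurd h hβ⟩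
  choose η hη using hnext
  have hprev : ∀ γ : α, ∃ U ∈ I, ∀ m, IsGreatest (X ∩ Set.Iic γ) m → W m ⊆ U ∧
      ∀ i ∉ U, f m i ≤ f γ i := by
    intro γ
    by_cases h : ∃ m, IsGreatest (X ∩ Set.Iic γ) m
    · obtain ⟨m, hm⟩ := h
      rcases (show m ≤ γ from hm.1.2).eq_or_lt with rfl | hlt
      · refine ⟨W m, hW m, fun m' hm' => ?_⟩
        obtain rfl := hm'.unique hm
        exact ⟨subset_rfl, fun _ _ => le_rfl⟩
      · refine ⟨W m ∪ {i | f γ i ≤ f m i}, Order.Ideal.union_mem (hW m) (hf _ _ hlt),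
          fun m' hm' => ?_⟩
        obtain rfl := hm'.unique hm
        refine ⟨Set.subset_union_left, fun i hi => ?_⟩
        simp only [Set.mem_union, Set.mem_ofPred_eq, not_or, not_le] at hi
        exact hi.2.le
    · exact ⟨∅, Order.Ideal.empty_mem I, fun m hm => absurd ⟨m, hm⟩ h⟩
  choose U hU hUm using hprev
  refine ⟨fun β => if β < δ then
    (Z (η β) β ∪ (W (η β) ∪ {i | f (η β) i ≤ f β i})) ∪ U β else ∅, fun β => ?_, ?_⟩
  · dsimp only
    split_ifs with hβ
    · exact Order.Ideal.union_mem (Order.Ideal.union_mem (hZ _ (hη β hβ).1.1 _)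
        (Order.Ideal.union_mem (hW _) (hf _ _ (hη β hβ).1.2))) (hU β)
    · exact Order.Ideal.empty_mem I
  · intro β hβ γ hγ hlt i hi
    have hβδ : β < δ := hx hβ
    have hγδ : γ < δ := hx hγ
    simp only [hβδ, hγδ, if_true, Set.mem_union, Set.mem_ofPred_eq, not_or, not_le] at hi
    obtain ⟨⟨⟨hZβ, hWβ, hηβ⟩, -⟩, ⟨⟨hZγ, -, -⟩, hUγ⟩⟩ := hi
    -- If `X` meets `(β, γ]`, let `m` be its last point there: `f β < f (η β) ≤ f m ≤ f γ` at `i`.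
    -- Otherwise `β` and `γ` have the same next point of `X`, and `Z (η β)` decides.
    by_cases hle : η β ≤ γ
    · obtain ⟨m, hm⟩ := hclosed γ hγδ (η β) (hη β hβδ).1.1 hle
      have hηm : η β ≤ m := hm.2 ⟨(hη β hβδ).1.1, hle⟩
      refine lt_of_lt_of_le (hηβ.trans_le ?_) ((hUm γ m hm).2 i hUγ)
      rcases hηm.eq_or_lt with heq | hlt'
      · rw [heq]
      · refine (hWlt _ (hη β hβδ).1.1 m hm.1.1 hlt' i ?_).le
        simp only [Set.mem_union, not_or]
        exact ⟨hWβ, fun h => hUγ ((hUm γ m hm).1 h)⟩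
    · have hγη : γ < η β := not_le.1 hle
      have heq : η β = η γ := le_antisymm
        ((hη β hβδ).2 ⟨(hη γ hγδ).1.1, hlt.trans (hη γ hγδ).1.2⟩)
        ((hη γ hγδ).2 ⟨(hη β hβδ).1.1, hγη⟩)
      rw [← heq] at hZγ
      exact hZlt _ (hη β hβδ).1.1 β ⟨hβ, (hη β hβδ).1.2⟩ γ ⟨hγ, hγη⟩ hlt i (by simp [hZβ, hZγ])

theorem IsClub.exists_isGreatest_inter_Iic [WellFoundedLT α] {X : Set α} (hX : IsClub X)
    {γ ξ : α} (hξ : ξ ∈ X) (hξγ : ξ ≤ γ) : ∃ m, IsGreatest (X ∩ Set.Iic γ) m := by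
  have hne : (upperBounds (X ∩ Set.Iic γ)).Nonempty := ⟨γ, fun z hz => hz.2⟩
  have hlub : IsLUB (X ∩ Set.Iic γ) (WellFounded.min wellFounded_lt _ hne) :=
    ⟨WellFounded.min_mem _ _ hne, fun z hz => WellFounded.min_le _ hz⟩
  exact ⟨_, ⟨hX.isLUB_mem Set.inter_subset_left ⟨ξ, hξ, hξγ⟩ hlub,
    hlub.2 fun z hz => hz.2⟩, hlub.1⟩

end Free

/-! ### Freeness from remarkably good points -/

theorem IsRemarkablyGoodPoint.isFreeOn {A : Set Cardinal.{u}} {I : Order.Ideal (Set A)}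
    {π : Cardinal.{u}} {f : Iio π.ord → CardProd A}
    (hf : ∀ α β, α < β → {i | f β i ≤ f α i} ∈ I) {δ : Iio π.ord}
    (hδ : IsRemarkablyGoodPoint I f δ) {x : Set (Iio π.ord)} (hx : x ⊆ Iio δ)
    (hfree : ∀ η < δ, IsFreeOn I f (x ∩ Iio η)) : IsFreeOn I f x := by
  classical
  obtain ⟨hlim, X, hX, Z, hZ, hlt⟩ := hδ
  refine IsFreeOn.of_closed_unbounded (X := Subtype.val '' X) hf hx ?_ ?_ ?_ ?_
  · rintro _ ⟨η, -, rfl⟩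
    exact hfree η η.2
  · refine ⟨fun β => if h : ∃ hβ : β ∈ Iio δ, (⟨β, hβ⟩ : Iio δ) ∈ X then Z ⟨β, h.1⟩ else ∅,
      fun β => ?_, ?_⟩
    · dsimp only
      split_ifs with h
      · exact hZ _ h.2
      · exact Order.Ideal.empty_mem I
    · rintro _ ⟨β, hβ, rfl⟩ _ ⟨ξ, hξ, rfl⟩ hβξ i hi
      have h₁ : ∃ h : (β : Iio π.ord) ∈ Iio δ, (⟨β, h⟩ : Iio δ) ∈ X := ⟨β.2, hβ⟩
      have h₂ : ∃ h : (ξ : Iio π.ord) ∈ Iio δ, (⟨ξ, h⟩ : Iio δ) ∈ X := ⟨ξ.2, hξ⟩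
      dsimp only at hi
      rw [dif_pos h₁, dif_pos h₂] at hi
      exact hlt β hβ ξ hξ hβξ i hi
  · intro β hβ
    have hs : succ (β : Ordinal) < δ := hlim.succ_lt hβ
    obtain ⟨η, hη, hle⟩ := hX.isCofinal ⟨⟨succ (β : Ordinal), hs.trans δ.2⟩, hs⟩
    exact ⟨η, ⟨η, hη, rfl⟩, (lt_succ (β : Ordinal)).trans_le hle⟩
  · rintro γ hγ _ ⟨ξ, hξ, rfl⟩ hle
    obtain ⟨m, hm, hm'⟩ := hX.exists_isGreatest_inter_Iic (γ := ⟨γ, hγ⟩) hξ hle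
    refine ⟨m, ⟨⟨m, hm.1, rfl⟩, hm.2⟩, ?_⟩
    rintro _ ⟨⟨z, hz, rfl⟩, hzγ⟩
    exact hm' ⟨hz, hzγ⟩

/-- Only the case where `x` is unbounded in `γ` is serious: then `γ = sup x` lies in `C` and has
cofinality at most `#x < κ`, so it is remarkably good. -/
theorem isFreeOn_of_forall_isRemarkablyGoodPoint {A : Set Cardinal.{u}} {I : Order.Ideal (Set A)}
    {κ π : Cardinal.{u}} {f : Iio π.ord → CardProd A}
    (hf : ∀ α β, α < β → {i | f β i ≤ f α i} ∈ I) {C : Set (Iio π.ord)} (hC : IsClub C)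
    (hgood : ∀ δ ∈ C, IsSuccLimit (δ : Ordinal.{u}) → (δ : Ordinal.{u}).cof < κ →
      IsRemarkablyGoodPoint I f δ)
    (γ : Iio π.ord) {x : Set (Iio π.ord)} (hxC : x ⊆ C) (hxγ : x ⊆ Iio γ)
    (hxκ : #x < Cardinal.lift.{u + 1} κ) : IsFreeOn I f x := by
  induction γ using WellFoundedLT.induction generalizing x with
  | ind γ ih =>
  have hsub : ∀ η < γ, IsFreeOn I f (x ∩ Iio η) := fun η hη =>
    ih η hη (Set.inter_subset_left.trans hxC) Set.inter_subset_right
      ((mk_le_mk_of_subset Set.inter_subset_left).trans_lt hxκ)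
  by_cases h : ∃ η < γ, x ⊆ Set.Iic η
  · obtain ⟨η, hη, hxη⟩ := h
    refine (IsFreeOn.insert_of_subset_Iio hf (hsub η hη) Set.inter_subset_right).mono
      fun z hz => ?_
    rcases (show z ≤ η from hxη hz).eq_or_lt with rfl | hlt
    · exact Set.mem_insert _ _
    · exact Set.mem_insert_of_mem _ ⟨hz, hlt⟩
  · have hcof : ∀ η < γ, ∃ ξ ∈ x, η < ξ := by
      intro η hη
      by_contra! h'
      exact h ⟨η, hη, h'⟩
    rcases x.eq_empty_or_nonempty with rfl | hne
    · exact ⟨fun _ => ∅, fun _ => Order.Ideal.empty_mem I, fun β hβ => hβ.elim⟩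
    have hlub : IsLUB x γ := by
      refine ⟨fun z hz => le_of_lt (hxγ hz), fun z hz => ?_⟩
      by_contra! hlt
      obtain ⟨ξ, hξ, hlt'⟩ := hcof z hlt
      exact (hz hξ).not_gt hlt'
    have hlim : IsSuccLimit (γ : Ordinal.{u}) := by
      obtain ⟨z, hz⟩ := hne
      refine (Order.isSuccLimit_iff _).2 ⟨?_, ?_⟩
      · exact not_isMin_of_lt (show (z : Ordinal) < γ from hxγ hz)
      · refine Order.isSuccPrelimit_of_succ_lt fun o ho => ?_
        obtain ⟨ξ, hξ, hlt⟩ := hcof ⟨o, ho.trans γ.2⟩ ho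
        exact (Order.succ_le_of_lt (show o < (ξ : Ordinal) from hlt)).trans_lt (hxγ hξ)
    have hcard : (γ : Ordinal.{u}).cof < κ := by
      rw [← Cardinal.lift_lt.{u, u + 1}, Ordinal.lift_cof, ← Ordinal.cof_Iio]
      refine lt_of_le_of_lt ?_ hxκ
      let g : x → Iio (γ : Ordinal.{u}) := fun z => ⟨z.1.1, hxγ z.2⟩
      refine (Order.cof_le (s := Set.range g) fun o => ?_).trans mk_range_le
      obtain ⟨ξ, hξ, hlt⟩ := hcof ⟨o.1, (show o.1 < γ.1 from o.2).trans γ.2⟩ o.2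
      exact ⟨g ⟨ξ, hξ⟩, ⟨_, rfl⟩, hlt.le⟩
    exact (hgood γ (hC.isLUB_mem hxC hne hlub) hlim hcard).isFreeOn hf hxγ hsub

/-! ### Counting and colouring -/

/-- The least elements of `C` above the subsets of `c` are at most `#c + 1` many. -/
theorem mk_image_powerset_isLeast_le {α : Type*} [LinearOrder α] [WellFoundedLT α] {C c : Set α}
    {g : Set α → α} (hg : ∀ a ⊆ c, IsLeast (C ∩ upperBounds a) (g a)) :
    #(g '' 𝒫 c) ≤ #c + 1 := by
  classical
  -- `g a` depends only on the upper bounds of `a`, so `a` may be replaced by the initial segment of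
  -- `c` it generates: `c ∩ Iio γ`, or all of `c` for `none`.
  let G : Option c → α := fun o => o.elim (g c) fun γ => g (c ∩ Iio γ)
  have hsub : g '' 𝒫 c ⊆ Set.range G := by
    rintro _ ⟨a, ha, rfl⟩
    have key : ∀ b ⊆ c, a ⊆ b → (∀ β ∈ b, ∃ ξ ∈ a, β ≤ ξ) → g b = g a := by
      intro b hb hab hba
      have hub : upperBounds b = upperBounds a := by
        refine Set.Subset.antisymm (upperBounds_mono_set hab) fun z hz β hβ => ?_
        obtain ⟨ξ, hξ, hle⟩ := hba β hβ
        exact hle.trans (hz hξ)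
      have h := hg b hb
      rw [hub] at h
      exact h.unique (hg a ha)
    by_cases h : ∃ γ ∈ c, ∀ ξ ∈ a, ξ < γ
    · have hne : {γ | γ ∈ c ∧ ∀ ξ ∈ a, ξ < γ}.Nonempty := h
      obtain ⟨hγ, hγa⟩ := WellFounded.min_mem (wellFounded_lt (α := α)) _ hne
      set γ := WellFounded.min (wellFounded_lt (α := α)) _ hne with hγdef
      refine ⟨some ⟨γ, hγ⟩, key _ Set.inter_subset_left (fun z hz => ⟨ha hz, hγa z hz⟩) ?_⟩
      rintro β ⟨hβ, hβγ⟩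
      by_contra! hlt
      exact (WellFounded.min_le (wellFounded_lt (α := α))
        (show β ∈ {γ | γ ∈ c ∧ ∀ ξ ∈ a, ξ < γ} from ⟨hβ, hlt⟩)).not_gt hβγ
    · push Not at h
      exact ⟨none, key c subset_rfl ha h⟩
  calc #(g '' 𝒫 c) ≤ #(Set.range G) := mk_le_mk_of_subset hsub
    _ ≤ #(Option c) := mk_range_le
    _ = #c + 1 := mk_option

/-- The partitions are the fibres of `F a`, at most `#ι` in number. -/
theorem PSPlus.exists_cofinal_of_coloring {κ μ : Cardinal.{u}} {ι : Type (u + 1)}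
    (h : PSPlus (succ #ι) κ μ) (F : PSub κ μ → PSub κ μ → ι) :
    ∃ B : Set (PSub κ μ), (∀ a : PSub κ μ, ∃ b ∈ B, a.1 ⊆ b.1) ∧ ∃ k : PSub κ μ → ι,
      ∀ a ∈ B, ∀ b ∈ B, ∃ c : PSub κ μ, a.1 ⊆ c.1 ∧ b.1 ⊆ c.1 ∧ F a c = k a ∧ F b c = k b := by
  obtain ⟨B, hB, p, hp, hsel⟩ := h (fun a => (Setoid.ker (F a)).classes) fun a => by
    refine ⟨Setoid.isPartition_classes _, lt_succ_of_le ?_⟩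
    have hsub : (Setoid.ker (F a)).classes ⊆ Set.range fun i : ι => {x | F a x = i} := by
      rintro _ ⟨c, rfl⟩
      exact ⟨F a c, rfl⟩
    exact (mk_le_mk_of_subset hsub).trans mk_range_le
  choose d hd using hp
  refine ⟨B, fun a => ?_, fun a => F a (d a), fun a ha b hb => ?_⟩
  · by_contra! hno
    refine hB (Set.mem_iUnion.2 ⟨a, fun b hb => ?_⟩)
    exact Set.sdiff_nonempty.2 (hno b hb)
  · obtain ⟨c, ⟨hca, hcb⟩, hsub⟩ := hsel a ha b hb
    rw [hd a] at hca
    rw [hd b] at hcb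
    exact ⟨c, Set.subset_union_left.trans hsub, Set.subset_union_right.trans hsub, hca, hcb⟩

theorem exists_isLeast_inter_upperBounds {α : Type*} [LinearOrder α] [WellFoundedLT α]
    {C : Set α} (hC : IsCofinal C) {a : Set α} (ha : BddAbove a) :
    ∃ m, IsLeast (C ∩ upperBounds a) m := by
  obtain ⟨z, hz⟩ := ha
  obtain ⟨y, hy, hzy⟩ := hC z
  have hne : (C ∩ upperBounds a).Nonempty := ⟨y, hy, fun w hw => (hz hw).trans hzy⟩
  exact ⟨WellFounded.min wellFounded_lt _ hne, WellFounded.min_mem _ _ hne,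
    fun w hw => WellFounded.min_le _ hw⟩

theorem cof_Iio_ord_of_isRegular {π : Cardinal.{u}} (hπ : π.IsRegular) :
    Order.cof (Iio π.ord) = Cardinal.lift.{u + 1} π := by
  rw [Ordinal.cof_Iio, ← Ordinal.lift_cof, hπ.cof_ord]

/-! ### The main argument -/

theorem proposition2p15 (κ lam : Cardinal.{u})
    (hκ : κ.IsRegular) (hκ_unc : ℵ₀ < κ) (hκlam : κ ≤ lam)
    (A : Set Cardinal.{u}) (hA_inf : A.Infinite) (hA_reg : ∀ a ∈ A, a.IsRegular)
    (hA_κ : #A < Cardinal.lift.{u + 1} κ) (hA_min : ∀ a ∈ A, #A < Cardinal.lift.{u + 1} a)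
    (hA_sup : IsLUB A lam)
    (I : Order.Ideal (Set A)) (hI : I.IsProper)
    (hI_bdd : ∀ a ∈ A, {b : A | (b : Cardinal.{u}) < a} ∈ I)
    (htcf : HasTcf I (succ lam))
    (hPS : PSPlus (succ #A) κ (succ lam))
    (f : Iio (succ lam).ord → CardProd A) (hf : IsScale I f) :
    IsStationary {δ : Iio (succ lam).ord |
      IsSuccLimit (δ : Ordinal.{u}) ∧ (δ : Ordinal.{u}).cof < κ ∧
        ¬ IsRemarkablyGoodPoint I f δ} := by
  classical
  have hωlam : ℵ₀ ≤ lam := hκ_unc.le.trans hκlam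
  have hcof : Order.cof (Iio (succ lam).ord) = Cardinal.lift.{u + 1} (succ lam) := cof_Iio_ord_of_isRegular htcf.1
  have hκπ : Cardinal.lift.{u + 1} κ < Cardinal.lift.{u + 1} (succ lam) :=
    Cardinal.lift_lt.2 (hκlam.trans_lt (lt_succ lam))
  have hbdd : ∀ x : Set (Iio (succ lam).ord), #x < Cardinal.lift.{u + 1} κ → BddAbove x := fun x hx =>
    .of_not_isCofinal fun h => (Order.cof_le h).not_gt (hcof ▸ hx.trans hκπ)
  have hsmall : ∀ c : PSub κ (succ lam), ∀ a ⊆ c.1, #a < Cardinal.lift.{u + 1} κ := fun c a ha =>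
    (mk_le_mk_of_subset ha).trans_lt c.2
  by_contra hns
  obtain ⟨C, hC, hdisj⟩ := not_isStationary_iff.1 hns
  have hgood : ∀ δ ∈ C, IsSuccLimit (δ : Ordinal.{u}) → (δ : Ordinal.{u}).cof < κ →
      IsRemarkablyGoodPoint I f δ := fun δ hδ h₁ h₂ => by
    by_contra h₃
    exact Set.disjoint_left.1 hdisj ⟨h₁, h₂, h₃⟩ hδ
  have hfree : ∀ x ⊆ C, #x < Cardinal.lift.{u + 1} κ → IsFreeOn I f x := by
    intro x hxC hx
    obtain ⟨z, hz⟩ := hbdd x hx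
    have hs : succ (z : Ordinal) < (succ lam).ord :=
      (isSuccLimit_ord (hωlam.trans (le_succ lam))).succ_lt z.2
    exact isFreeOn_of_forall_isRemarkablyGoodPoint hf.increasing hC hgood ⟨_, hs⟩ hxC
      (fun w hw => (show (w : Ordinal) ≤ z from hz hw).trans_lt (lt_succ (z : Ordinal))) hx
  have hleast : ∀ a : Set (Iio (succ lam).ord), ∃ m, #a < Cardinal.lift.{u + 1} κ →
      IsLeast (C ∩ upperBounds a) m := fun a => by
    by_cases ha : #a < Cardinal.lift.{u + 1} κ
    · obtain ⟨m, hm⟩ := exists_isLeast_inter_upperBounds hC.isCofinal (hbdd a ha)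
      exact ⟨m, fun _ => hm⟩
    · exact ⟨⟨0, by simp⟩, fun h => absurd h ha⟩
  choose g hg using hleast
  have hfree' : ∀ c : PSub κ (succ lam), IsFreeOn I f (g '' 𝒫 c.1) := by
    intro c
    refine hfree _ ?_ ?_
    · rintro _ ⟨a, ha, rfl⟩
      exact (hg a (hsmall c a ha)).1.1
    -- Counting subsets of `c` would not do, since `2 ^ #c` may reach `κ`.
    · refine (mk_image_powerset_isLeast_le fun a ha => hg a (hsmall c a ha)).trans_lt ?_
      have hω : ℵ₀ ≤ Cardinal.lift.{u + 1} κ := aleph0_le_lift.2 hκ.aleph0_le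
      exact add_lt_of_lt hω c.2 (one_lt_aleph0.trans_le hω)
  choose Z hZ hZlt using hfree'
  have hex : ∀ a c : PSub κ (succ lam), ∃ i : A, i ∉ Z c (g a.1) := by
    intro a c
    by_contra! h
    have huniv : Z c (g a.1) = ⊤ := Set.eq_univ_of_forall h
    exact Order.Ideal.isProper_iff_top_notMem.1 hI (huniv ▸ hZ c (g a.1))
  choose F hF using hex
  obtain ⟨B, hB, k, hk⟩ := hPS.exists_cofinal_of_coloring F
  have hcofB : IsCofinal (⋃ i : A, {α | ∃ a ∈ B, k a = i ∧ g a.1 = α}) := by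
    intro z
    have h1 : #({z} : Set (Iio (succ lam).ord)) < Cardinal.lift.{u + 1} κ := by
      rw [mk_singleton]
      exact one_lt_aleph0.trans_le (aleph0_le_lift.2 hκ.aleph0_le)
    obtain ⟨b, hb, hzb⟩ := hB ⟨{z}, h1⟩
    exact ⟨g b.1, Set.mem_iUnion.2 ⟨k b, b, hb, rfl, rfl⟩,
      (hg b.1 b.2).1.2 (hzb (Set.mem_singleton z))⟩
  -- Fewer than `cf(λ⁺)` pieces cover a cofinal set, so one piece is cofinal.
  obtain ⟨i, hi⟩ := isCofinal_of_isCofinal_iUnion hcofB (by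
    rw [hcof]; exact hA_κ.trans hκπ)
  have hmono : ∀ α ∈ {α | ∃ a ∈ B, k a = i ∧ g a.1 = α},
      ∀ β ∈ {α | ∃ a ∈ B, k a = i ∧ g a.1 = α}, α < β → f α i < f β i := by
    rintro _ ⟨a, ha, hka, rfl⟩ _ ⟨b, hb, hkb, rfl⟩ hlt
    obtain ⟨c, hac, hbc, hFa, hFb⟩ := hk a ha b hb
    refine hZlt c _ ⟨a.1, hac, rfl⟩ _ ⟨b.1, hbc, rfl⟩ hlt i ?_
    rintro (h | h)
    · exact hF a c (by rwa [hFa, hka])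
    · exact hF b c (by rwa [hFb, hkb])
  have hinj : Function.Injective
      fun α : {α | ∃ a ∈ B, k a = i ∧ g a.1 = α} => f α.1 i := by
    intro α β hαβ
    by_contra hne
    rcases lt_or_gt_of_ne hne with h | h
    · exact (hmono _ α.2 _ β.2 h).ne hαβ
    · exact (hmono _ β.2 _ α.2 h).ne' hαβ
  have hle : Cardinal.lift.{u + 1} (succ lam) ≤ Cardinal.lift.{u + 1} (i : Cardinal.{u}) :=
    calc Cardinal.lift.{u + 1} (succ lam) = Order.cof (Iio (succ lam).ord) := hcof.symm
      _ ≤ _ := Order.cof_le hi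
      _ ≤ #(Iio (i : Cardinal.{u}).ord) := mk_le_of_injective hinj
      _ = _ := by rw [Cardinal.mk_Iio_ordinal, card_ord]
  exact ((hA_sup.1 i.2).trans_lt (lt_succ lam)).not_ge (Cardinal.lift_le.1 hle)
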